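/- **Theorem.** There is an absolute constant $c>0$ such that the following holds for all reals $0<\epsilon<1/5$ and $\Delta>1$: every quantum algorithm that solves the Mean Estimation problem for the parameters $\epsilon,\Delta$ on the sample space $\Omega=\{0,1\}$ uses at least $c\,(\Delta-1)/\epsilon$ quantum samples (so $\Omega((\Delta-1)/\epsilon)$ quantum samples are necessary). This already holds for algorithms that are only required to work for samplers with one fixed garbage space $\mathcal H_g$. The notions are as follows. *Samplers.* Let $\mathcal H_\Omega$ be the Hilbert space with orthonormal basis $\{|x\rangle\}_{x\in\Omega}$, let $\mathcal H_g$ be a complex Hilbert space and let $|0\rangle_g\in\mathcal H_g$ be a unit vector. A (quantum) sampler for a probability distribution $d$ on $\Omega$ is a unitary $\mathcal S$ on $\mathcal H_g\otimes\mathcal H_\Omega$ such that $\mathcal S(|0\rangle_g|0\rangle)=\sum_{x\in\Omega}\sqrt{d(x)}\,|\psi_x\rangle|x\rangle$ for some unit vectors $|\psi_x\rangle\in\mathcal H_g$. Put $\mu_{\mathcal S}=\sum_x d(x)\,x$ and $\phi_{\mathcal S}=\bigl(\sum_x d(x)\,x^2\bigr)^{1/2}$. A quantum sample is one execution of $\mathcal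 S$ or $\mathcal S^{-1}$, or of the controlled version $|0\rangle\langle0|\otimes I+|1\rangle\langle1|\otimes U$ of $U=\mathcal S$ or $U=\mathcal S^{-1}$. *Algorithms.* A quantum algorithm using $N$ quantum samples acts on $\mathbb C^2\otimes W\otimes(\mathcal H_g\otimes\mathcal H_\Omega)$, where $\mathbb C^2$ is a control qubit and $W$ is an arbitrary workspace, a complex Hilbert space. (If both $W$ and $\mathcal H_g$ are infinite-dimensional, $\otimes$ is the algebraic tensor product with its inner product; otherwise this is the usual Hilbert tensor product.) It starts in a fixed unit vector, performs $N$ steps, each consisting of one quantum sample (of a prescribed kind among the four above) followed by a unitary independent of $\mathcal S$, and finally makes a measurement (POVM) with finitely many outcomes, independent of $\mathcal S$, each outcome being labelled by a real number, the output $\widetilde\mu$. *Mean Estimation problem.* The algorithm solves the problem for the parameters $\epsilon,\Delta$ if for every sampler $\mathcal S$ on $\mathcal H_g\otimes\mathcal H_\Omega$ with $\phi_{\mathcal S}/\mu_{\mathcal S}\in[\Delta,4\Delta]$, its output satisfies $|\widetilde\mu-\mu_{\mathcal S}|\le\epsilon\,\mu_{\mathcal S}$ with probability at least $2/3$. -/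

import Mathlib

open scoped TensorProduct

noncomputable section

namespace QuantumSampling

/-- The Hilbert space `H_Ω` with orthonormal basis `|x⟩`, `x ∈ Ω`. -/
abbrev ValueSpace (Ω : Finset ℝ) : Type := EuclideanSpace ℂ Ω

/-- The basis state `|x⟩` of `H_Ω`. -/
def ket {Ω : Finset ℝ} (x : Ω) : ValueSpace Ω := EuclideanSpace.single x 1

/-- The space `H_g ⊗ H_Ω` on which a sampler acts. -/
abbrev SampleSpace (Hg : Type*) [NormedAddCommGroup Hg] [InnerProductSpace ℂ Hg]
    (Ω : Finset ℝ) : Type _ := Hg ⊗[ℂ] ValueSpace Ω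

/-- A probability distribution on the finite set `Ω`. -/
structure IsDistribution {Ω : Finset ℝ} (d : Ω → ℝ) : Prop where
  nonneg : ∀ x, 0 ≤ d x
  sum_eq_one : ∑ x, d x = 1

/-- The mean `μ = E[X]` of a distribution. -/
def mean {Ω : Finset ℝ} (d : Ω → ℝ) : ℝ := ∑ x, d x * (x : ℝ)

/-- The quantity `φ`, the square root of the second moment: `φ² = E[X²]`. -/
def phi {Ω : Finset ℝ} (d : Ω → ℝ) : ℝ := √(∑ x, d x * (x : ℝ) ^ 2)

section Sampler

variable {Hg : Type*} [NormedAddCommGroup Hg] [InnerProductSpace ℂ Hg] {Ω : Finset ℝ}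

/-- The unitary `S` on `H_g ⊗ H_Ω` is a quantum sampler for the distribution `d`, with respect to
the initial state `|g₀⟩|x₀⟩`:
`S |g₀⟩|x₀⟩ = ∑ x, √d(x) |ψ_x⟩|x⟩` for some unit vectors `ψ_x ∈ H_g`. -/
def IsSampler (g₀ : Hg) (x₀ : Ω) (d : Ω → ℝ)
    (S : SampleSpace Hg Ω ≃ₗᵢ[ℂ] SampleSpace Hg Ω) : Prop :=
  ∃ ψ : Ω → Hg, (∀ x, ‖ψ x‖ = 1) ∧
    S (g₀ ⊗ₜ[ℂ] ket x₀) = ∑ x, ((√(d x) : ℝ) : ℂ) • (ψ x ⊗ₜ[ℂ] ket x)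

end Sampler

/-- One qubit. -/
abbrev Qubit : Type := EuclideanSpace ℂ (Fin 2)

/-- The projection `|i⟩⟨i|` of a qubit. -/
def Qubit.proj (i : Fin 2) : Qubit →L[ℂ] Qubit :=
  InnerProductSpace.rankOne ℂ (EuclideanSpace.single i (1 : ℂ)) (EuclideanSpace.single i (1 : ℂ))

/-- A measurement on `H` with finitely many outcomes (a positive operator-valued measure), each
outcome being labelled by a real number. -/
structure Measurement (H : Type*) [NormedAddCommGroup H] [InnerProductSpace ℂ H] where
  numOutcomes : ℕ
  effect : Fin numOutcomes → (H →L[ℂ] H)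
  effect_isPositive : ∀ i, (effect i).IsPositive
  effect_sum : ∑ i, effect i = ContinuousLinearMap.id ℂ H
  label : Fin numOutcomes → ℝ

open Classical in
/-- The probability that the label of the outcome lies in `B`, when the state `v` is measured. -/
def Measurement.prob {H : Type*} [NormedAddCommGroup H] [InnerProductSpace ℂ H]
    (M : Measurement H) (v : H) (B : Set ℝ) : ℝ :=
  ∑ i with M.label i ∈ B, (inner ℂ v (M.effect i v)).re

/-- The four kinds of quantum samples: one execution of `S` or of `S⁻¹`, or of their controlled
versions. -/
inductive SampleKind : Type
  | direct
  | inverse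
  | controlledDirect
  | controlledInverse

/-- The private memory of an algorithm: a control qubit together with a workspace `W`. -/
def Private (W : Type*) [NormedAddCommGroup W] [InnerProductSpace ℂ W] : Type _ :=
  Qubit ⊗[ℂ] W

section Private

variable (W : Type*) [NormedAddCommGroup W] [InnerProductSpace ℂ W]

instance : NormedAddCommGroup (Private W) := inferInstanceAs (NormedAddCommGroup (Qubit ⊗[ℂ] W))

instance : InnerProductSpace ℂ (Private W) := inferInstanceAs (InnerProductSpace ℂ (Qubit ⊗[ℂ] W))

/-- The projection `|i⟩⟨i| ⊗ I` on the private memory, for the control qubit. -/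
def controlProj (i : Fin 2) : Private W →L[ℂ] Private W :=
  (Qubit.proj i).rTensor W

end Private

/-- The memory of an algorithm: its private memory, together with the register `K` on which the
unitary given as a black box acts. -/
abbrev Memory (W K : Type*) [NormedAddCommGroup W] [InnerProductSpace ℂ W]
    [NormedAddCommGroup K] [InnerProductSpace ℂ K] : Type _ :=
  Private W ⊗[ℂ] K

section Algorithm

variable {W K : Type*} [NormedAddCommGroup W] [InnerProductSpace ℂ W]
  [NormedAddCommGroup K] [InnerProductSpace ℂ K]

/-- The unitary `U` acting on the register `K` of the memory. -/
def uncontrolled (U : K ≃ₗᵢ[ℂ] K) : Memory W K →L[ℂ] Memory W K :=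
  TensorProduct.mapL (ContinuousLinearMap.id ℂ (Private W)) (U : K →L[ℂ] K)

/-- The controlled version `|0⟩⟨0| ⊗ I ⊗ I + |1⟩⟨1| ⊗ I ⊗ U` of a unitary `U`. -/
def controlled (U : K ≃ₗᵢ[ℂ] K) : Memory W K →L[ℂ] Memory W K :=
  TensorProduct.mapL (controlProj W 0) (ContinuousLinearMap.id ℂ K) +
    TensorProduct.mapL (controlProj W 1) (U : K →L[ℂ] K)

/-- One quantum sample from `S`, applied to the memory of an algorithm. -/
def sample (S : K ≃ₗᵢ[ℂ] K) : SampleKind → (Memory W K →L[ℂ] Memory W K)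
  | .direct => uncontrolled S
  | .inverse => uncontrolled S.symm
  | .controlledDirect => controlled S
  | .controlledInverse => controlled S.symm

variable (W K) in
/-- A quantum algorithm with black-box access to a unitary on `K`. It starts in a fixed unit
vector, then performs a finite sequence of steps, each consisting of one quantum sample followed by
a unitary that does not depend on the black box, and finally makes a measurement, whose outcome is
the real number that the algorithm outputs. -/
structure Algorithm where
  init : Memory W K
  norm_init : ‖init‖ = 1
  steps : List (SampleKind × (Memory W K ≃ₗᵢ[ℂ] Memory W K))
  measurement : Measurement (Memory W K)

/-- The number of quantum samples that the algorithm uses. -/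
def Algorithm.numSamples (A : Algorithm W K) : ℕ := A.steps.length

/-- The state of the memory just before the final measurement. -/
def Algorithm.finalState (A : Algorithm W K) (S : K ≃ₗᵢ[ℂ] K) : Memory W K :=
  A.steps.foldl (fun v s => s.2 (sample S s.1 v)) A.init

/-- The probability that the output of the algorithm, run on the sampler `S`, lies in `B`. -/
def Algorithm.prob (A : Algorithm W K) (S : K ≃ₗᵢ[ℂ] K) (B : Set ℝ) : ℝ :=
  A.measurement.prob (A.finalState S) B

/-- The algorithm solves the mean estimation problem for the parameters `ε`, `Δ`: on every sampler
with `φ / μ ∈ [Δ, 4Δ]`, its output is an estimate of `μ` with relative error `ε`, with probability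
at least `2/3`. -/
def Algorithm.SolvesMeanEstimation {Hg : Type*} [NormedAddCommGroup Hg]
    [InnerProductSpace ℂ Hg] {Ω : Finset ℝ} (A : Algorithm W (SampleSpace Hg Ω))
    (g₀ : Hg) (x₀ : Ω) (ε Δ : ℝ) : Prop :=
  ∀ (d : Ω → ℝ) (S : SampleSpace Hg Ω ≃ₗᵢ[ℂ] SampleSpace Hg Ω),
    IsDistribution d → IsSampler g₀ x₀ d S → phi d / mean d ∈ Set.Icc Δ (4 * Δ) →
      2 / 3 ≤ A.prob S {m | |m - mean d| ≤ ε * mean d}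

end Algorithm

/-- The sample space `{0, 1}`. -/
def bits : Finset ℝ := {0, 1}

/-- The element `0` of `{0, 1}`. -/
def zeroBit : bits := ⟨0, by simp [bits]⟩

end QuantumSampling

end

open scoped TensorProduct

noncomputable section

namespace QuantumSampling

/-! ### Measurements cannot separate nearby states -/

section Measurement

variable {H : Type*} [NormedAddCommGroup H] [InnerProductSpace ℂ H]

/-! The proof is a hybrid argument on two instances. On `{0, 1}` one has `x ^ 2 = x`, so a Bernoulli
law of mean `p` has `φ / μ = 1 / √p`. Take `p = 1 / Δ ^ 2` and `q = (1 - 2 * ε) * p`: both are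
admissible, and their intervals of correct answers are disjoint, so the algorithm must tell the two
samplers apart.

Realize both laws by plane rotations of the value register, leaving the garbage alone. These are
within `4 * ε / (Δ - 1)` in operator norm (`norm_rotationSampler_sub_le`, `abs_sqrt_sub_sqrt_le`).
Every kind of sample inherits this distance (`norm_sample_sub_le`), and the errors of `N` steps add
up (`norm_foldl_sample_sub_le`), so the final states differ by at most `N * (4 * ε / (Δ - 1))`.
Telling them apart with probability `2/3` needs distance `1/6`
(`Measurement.one_div_six_le_norm_sub`), whence `N ≥ (Δ - 1) / (24 * ε)`. -/

lemma Measurement.re_inner_effect_nonneg (M : Measurement H) (i : Fin M.numOutcomes) (v : H) :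
    0 ≤ (inner ℂ v (M.effect i v)).re :=
  (M.effect_isPositive i).re_inner_nonneg_right v

lemma Measurement.prob_nonneg (M : Measurement H) (v : H) (B : Set ℝ) : 0 ≤ M.prob v B :=
  Finset.sum_nonneg fun i _ => M.re_inner_effect_nonneg i v

lemma Measurement.sum_re_inner_effect (M : Measurement H) (v : H) :
    ∑ i, (inner ℂ v (M.effect i v)).re = ‖v‖ ^ 2 := by
  have h := congrArg (fun T : H →L[ℂ] H => (inner ℂ v (T v)).re) M.effect_sum
  simp only [_root_.sum_apply, inner_sum, Complex.re_sum, ContinuousLinearMap.id_apply] at h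
  rw [h]
  exact inner_self_eq_norm_sq (𝕜 := ℂ) v

lemma Measurement.prob_add_prob_le (M : Measurement H) (v : H) {B C : Set ℝ}
    (hBC : Disjoint B C) : M.prob v B + M.prob v C ≤ ‖v‖ ^ 2 := by
  classical
  rw [← M.sum_re_inner_effect v, Measurement.prob, Measurement.prob, ← Finset.sum_union]
  · exact Finset.sum_le_sum_of_subset_of_nonneg (Finset.subset_univ _)
      fun i _ _ => M.re_inner_effect_nonneg i v
  · refine Finset.disjoint_left.2 fun i hi hi' => ?_
    simp only [Finset.mem_filter] at hi hi'
    exact Set.disjoint_left.1 hBC hi.2 hi'.2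

lemma Measurement.prob_le (M : Measurement H) (v : H) (B : Set ℝ) : M.prob v B ≤ ‖v‖ ^ 2 := by
  linarith [M.prob_add_prob_le v (Set.disjoint_empty B), M.prob_nonneg v ∅]

/-- Polarization: the real part of the cross term between `v - w` and `v + w` is the difference of
the two outcome probabilities. Positivity of the left side then bounds that difference, with `t` a
free parameter in place of Cauchy–Schwarz. -/
lemma Measurement.re_inner_effect_identity (M : Measurement H) (i : Fin M.numOutcomes)
    (t : ℝ) (v w : H) :
    (inner ℂ ((t : ℂ) • (v - w) - (v + w)) (M.effect i ((t : ℂ) • (v - w) - (v + w)))).re =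
      t ^ 2 * (inner ℂ (v - w) (M.effect i (v - w))).re
        + (inner ℂ (v + w) (M.effect i (v + w))).re
        - 2 * t * ((inner ℂ v (M.effect i v)).re - (inner ℂ w (M.effect i w)).re) := by
  have h : (inner ℂ w (M.effect i v)).re = (inner ℂ v (M.effect i w)).re := by
    have h' : inner ℂ (M.effect i w) v = inner ℂ w (M.effect i v) :=
      (M.effect_isPositive i).isSymmetric w v
    rw [← h']
    exact inner_re_symm (𝕜 := ℂ) _ _
  simp only [map_sub, map_add, map_smul, inner_sub_left, inner_sub_right, inner_add_left,
    inner_add_right, inner_smul_left, inner_smul_right, Complex.conj_ofReal, Complex.sub_re,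
    Complex.add_re, Complex.re_ofReal_mul, h]
  ring

/-- Close states give close outcome probabilities. -/
lemma Measurement.mul_prob_sub_prob_le (M : Measurement H) (B : Set ℝ) (t : ℝ) (v w : H) :
    2 * t * (M.prob v B - M.prob w B) ≤ t ^ 2 * ‖v - w‖ ^ 2 + ‖v + w‖ ^ 2 := by
  have h : M.prob ((t : ℂ) • (v - w) - (v + w)) B =
      t ^ 2 * M.prob (v - w) B + M.prob (v + w) B - 2 * t * (M.prob v B - M.prob w B) := by
    simp only [Measurement.prob, M.re_inner_effect_identity, Finset.sum_add_distrib,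
      Finset.sum_sub_distrib, ← Finset.mul_sum]
  have h₀ := M.prob_nonneg ((t : ℂ) • (v - w) - (v + w)) B
  have h₁ := mul_le_mul_of_nonneg_left (M.prob_le (v - w) B) (sq_nonneg t)
  have h₂ := M.prob_le (v + w) B
  linarith

/-- Unit states that a measurement distinguishes with success probability `2/3` are far apart. -/
lemma Measurement.one_div_six_le_norm_sub (M : Measurement H) {B C : Set ℝ}
    (hBC : Disjoint B C) {v w : H} (hv : ‖v‖ = 1) (hw : ‖w‖ = 1)
    (hB : 2 / 3 ≤ M.prob v B) (hC : 2 / 3 ≤ M.prob w C) : 1 / 6 ≤ ‖v - w‖ := by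
  have h₁ := M.prob_add_prob_le w hBC
  -- The probabilities of `B` differ by at least `1/3`, so `t = 12` gives `8 ≤ 144 * ‖v - w‖ ^ 2 +
  -- 4`, which is exactly the bound `1/6`.
  have h₂ := M.mul_prob_sub_prob_le B 12 v w
  have h₃ : ‖v + w‖ ≤ 2 := (norm_add_le v w).trans (by rw [hv, hw]; norm_num)
  rw [hw] at h₁
  nlinarith [norm_nonneg (v + w), norm_nonneg (v - w)]

end Measurement

/-! ### Samples as isometries, and their dependence on the sampler -/

section Control

lemma Qubit.proj_apply (i : Fin 2) (v : Qubit) :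
    Qubit.proj i v = v i • EuclideanSpace.single i (1 : ℂ) := by
  simp [Qubit.proj, InnerProductSpace.rankOne_apply, EuclideanSpace.inner_single_left]

lemma Qubit.inner_proj_proj_of_ne {i j : Fin 2} (h : i ≠ j) (v w : Qubit) :
    inner ℂ (Qubit.proj i v) (Qubit.proj j w) = 0 := by
  simp [Qubit.proj_apply, EuclideanSpace.inner_single_left, h]

lemma Qubit.inner_proj_add_inner_proj (v w : Qubit) :
    inner ℂ (Qubit.proj 0 v) (Qubit.proj 0 w) + inner ℂ (Qubit.proj 1 v) (Qubit.proj 1 w) =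
      inner ℂ v w := by
  simp [Qubit.proj_apply, PiLp.inner_apply, Fin.sum_univ_two]

lemma Qubit.norm_proj_le (i : Fin 2) : ‖Qubit.proj i‖ ≤ 1 := by
  simp [Qubit.proj, InnerProductSpace.norm_rankOne]

variable {W K : Type*} [NormedAddCommGroup W] [InnerProductSpace ℂ W]
  [NormedAddCommGroup K] [InnerProductSpace ℂ K]

lemma norm_controlProj_le (i : Fin 2) : ‖controlProj W i‖ ≤ 1 :=
  (ContinuousLinearMap.norm_rTensor_le (G := W) (Qubit.proj i)).trans (Qubit.norm_proj_le i)

/-- A product state of the control qubit and the workspace. -/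
def Private.tmul (q : Qubit) (w : W) : Private W := q ⊗ₜ[ℂ] w

lemma controlProj_tmul (i : Fin 2) (q : Qubit) (w : W) :
    controlProj W i (Private.tmul q w) =
      (Private.tmul (Qubit.proj i q) w) := rfl

lemma inner_private_tmul (q q' : Qubit) (w w' : W) :
    inner ℂ (Private.tmul q w) (Private.tmul q' w') =
      inner ℂ q q' * inner ℂ w w' :=
  TensorProduct.inner_tmul (𝕜 := ℂ) q q' w w'

lemma Private.induction_on {P : Private W → Prop} (v : Private W) (zero : P 0)
    (tmul : ∀ (q : Qubit) (w : W), P (Private.tmul q w))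
    (add : ∀ v w, P v → P w → P (v + w)) : P v :=
  TensorProduct.induction_on (motive := P) v zero tmul add

lemma inner_controlProj_of_ne {i j : Fin 2} (h : i ≠ j) (v w : Private W) :
    inner ℂ (controlProj W i v) (controlProj W j w) = 0 := by
  induction v using Private.induction_on with
  | zero => simp
  | add v v' hv hv' => rw [map_add, inner_add_left, hv, hv', add_zero]
  | tmul q x =>
    induction w using Private.induction_on with
    | zero => simp
    | add w w' hw hw' => rw [map_add, inner_add_right, hw, hw', add_zero]
    | tmul q' y =>
      rw [controlProj_tmul, controlProj_tmul, inner_private_tmul,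
        Qubit.inner_proj_proj_of_ne h, zero_mul]

lemma inner_controlProj_add_inner_controlProj (v w : Private W) :
    inner ℂ (controlProj W 0 v) (controlProj W 0 w) +
      inner ℂ (controlProj W 1 v) (controlProj W 1 w) = inner ℂ v w := by
  induction v using Private.induction_on with
  | zero => simp
  | add v v' hv hv' =>
    simp only [map_add, inner_add_left, ← hv, ← hv']
    ring
  | tmul q x =>
    induction w using Private.induction_on with
    | zero => simp
    | add w w' hw hw' =>
      simp only [map_add, inner_add_right, ← hw, ← hw']
      ring
    | tmul q' y =>
      simp only [controlProj_tmul, inner_private_tmul]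
      rw [← add_mul, Qubit.inner_proj_add_inner_proj]

lemma controlled_tmul (U : K ≃ₗᵢ[ℂ] K) (v : Private W) (k : K) :
    controlled U (v ⊗ₜ[ℂ] k) =
      controlProj W 0 v ⊗ₜ[ℂ] k + controlProj W 1 v ⊗ₜ[ℂ] U k := rfl

/-- The two branches of the control qubit are orthogonal, and `U` preserves inner products on its
own branch. By additivity it suffices to check pure tensors. -/
lemma inner_controlled (U : K ≃ₗᵢ[ℂ] K) (v w : Memory W K) :
    inner ℂ (controlled U v) (controlled U w) = inner ℂ v w := by
  induction v using TensorProduct.induction_on with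
  | zero => simp
  | add v v' hv hv' => simp [inner_add_left, hv, hv']
  | tmul p k =>
    induction w using TensorProduct.induction_on with
    | zero => simp
    | add w w' hw hw' => simp [inner_add_right, hw, hw']
    | tmul p' k' =>
      simp only [controlled_tmul, inner_add_left, inner_add_right, TensorProduct.inner_tmul,
        inner_controlProj_of_ne (zero_ne_one : (0 : Fin 2) ≠ 1),
        inner_controlProj_of_ne (one_ne_zero : (1 : Fin 2) ≠ 0),
        LinearIsometryEquiv.inner_map_map, ← inner_controlProj_add_inner_controlProj p p']
      ring

lemma norm_controlled (U : K ≃ₗᵢ[ℂ] K) (v : Memory W K) : ‖controlled U v‖ = ‖v‖ := by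
  rw [norm_eq_sqrt_re_inner (𝕜 := ℂ), inner_controlled]
  exact (norm_eq_sqrt_re_inner (𝕜 := ℂ) v).symm

lemma norm_uncontrolled (U : K ≃ₗᵢ[ℂ] K) (v : Memory W K) : ‖uncontrolled U v‖ = ‖v‖ := by
  rw [uncontrolled, TensorProduct.mapL_apply]
  exact TensorProduct.norm_map (LinearIsometry.id (R := ℂ) (E := Private W)) U.toLinearIsometry v

lemma norm_sample (S : K ≃ₗᵢ[ℂ] K) (k : SampleKind) (v : Memory W K) : ‖sample S k v‖ = ‖v‖ := by
  cases k
  exacts [norm_uncontrolled _ _, norm_uncontrolled _ _, norm_controlled _ _, norm_controlled _ _]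

lemma norm_mapL_sub_mapL_le (P : Private W →L[ℂ] Private W) (hP : ‖P‖ ≤ 1)
    (S T : K →L[ℂ] K) : ‖TensorProduct.mapL P S - TensorProduct.mapL P T‖ ≤ ‖S - T‖ := by
  have h : TensorProduct.mapL P S = TensorProduct.mapL P (S - T) + TensorProduct.mapL P T := by
    rw [← TensorProduct.mapL_add_right, sub_add_cancel]
  rw [h, add_sub_cancel_right]
  exact (TensorProduct.norm_mapL_le _ _).trans
    (mul_le_of_le_one_left (norm_nonneg _) hP)

lemma norm_uncontrolled_sub_le (S T : K ≃ₗᵢ[ℂ] K) :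
    ‖(uncontrolled S - uncontrolled T : Memory W K →L[ℂ] Memory W K)‖ ≤
      ‖(S : K →L[ℂ] K) - (T : K →L[ℂ] K)‖ :=
  norm_mapL_sub_mapL_le _ ContinuousLinearMap.norm_id_le _ _

lemma norm_controlled_sub_le (S T : K ≃ₗᵢ[ℂ] K) :
    ‖(controlled S - controlled T : Memory W K →L[ℂ] Memory W K)‖ ≤
      ‖(S : K →L[ℂ] K) - (T : K →L[ℂ] K)‖ := by
  -- The control-`0` branches are identical and cancel.
  rw [controlled, controlled, add_sub_add_left_eq_sub]
  exact norm_mapL_sub_mapL_le _ (norm_controlProj_le 1) _ _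

/-- From `S⁻¹ - T⁻¹ = -S⁻¹ (S - T) T⁻¹` with `S⁻¹` and `T⁻¹` isometric. -/
lemma norm_symm_sub_symm_le (S T : K ≃ₗᵢ[ℂ] K) :
    ‖(S.symm : K →L[ℂ] K) - (T.symm : K →L[ℂ] K)‖ ≤ ‖(S : K →L[ℂ] K) - (T : K →L[ℂ] K)‖ := by
  refine ContinuousLinearMap.opNorm_le_bound _ (norm_nonneg _) fun x => ?_
  have h := ((S : K →L[ℂ] K) - (T : K →L[ℂ] K)).le_opNorm (T.symm x)
  have h' : S (S.symm x - T.symm x) = -(S (T.symm x) - T (T.symm x)) := by simp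
  calc ‖S.symm x - T.symm x‖ = ‖S (T.symm x) - T (T.symm x)‖ := by
        rw [← S.norm_map, h', norm_neg]
    _ ≤ _ := by simpa using h

lemma norm_sample_sub_le (S T : K ≃ₗᵢ[ℂ] K) (k : SampleKind) :
    ‖(sample S k - sample T k : Memory W K →L[ℂ] Memory W K)‖ ≤
      ‖(S : K →L[ℂ] K) - (T : K →L[ℂ] K)‖ := by
  cases k
  · exact norm_uncontrolled_sub_le S T
  · exact (norm_uncontrolled_sub_le _ _).trans (norm_symm_sub_symm_le S T)
  · exact norm_controlled_sub_le S T
  · exact (norm_controlled_sub_le _ _).trans (norm_symm_sub_symm_le S T)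

/-! ### Accumulation of errors along a run -/

lemma norm_foldl_sample (S : K ≃ₗᵢ[ℂ] K)
    (l : List (SampleKind × (Memory W K ≃ₗᵢ[ℂ] Memory W K))) (v : Memory W K) :
    ‖l.foldl (fun v s => s.2 (sample S s.1 v)) v‖ = ‖v‖ := by
  induction l generalizing v with
  | nil => rfl
  | cons s l ih => rw [List.foldl_cons, ih, LinearIsometryEquiv.norm_map, norm_sample]

/-- The hybrid argument. -/
lemma norm_foldl_sample_sub_le (S T : K ≃ₗᵢ[ℂ] K)
    (l : List (SampleKind × (Memory W K ≃ₗᵢ[ℂ] Memory W K))) (v w : Memory W K) (hw : ‖w‖ ≤ 1) :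
    ‖l.foldl (fun v s => s.2 (sample S s.1 v)) v - l.foldl (fun v s => s.2 (sample T s.1 v)) w‖ ≤
      ‖v - w‖ + l.length * ‖(S : K →L[ℂ] K) - (T : K →L[ℂ] K)‖ := by
  induction l generalizing v w with
  | nil => simp
  | cons s l ih =>
    rw [List.foldl_cons, List.foldl_cons]
    refine (ih _ _ (by rwa [LinearIsometryEquiv.norm_map, norm_sample])).trans ?_
    rw [← map_sub, LinearIsometryEquiv.norm_map]
    -- The old error is carried along isometrically; the new error comes only from `w`, hence the
    -- norm hypothesis on `w` alone.
    have h₁ : sample S s.1 v - sample T s.1 w =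
        sample S s.1 (v - w) + (sample S s.1 - sample T s.1 : Memory W K →L[ℂ] Memory W K) w := by
      rw [map_sub, _root_.sub_apply]
      abel
    have h₂ : ‖(sample S s.1 - sample T s.1 : Memory W K →L[ℂ] Memory W K) w‖ ≤ ‖(S : K →L[ℂ] K) - (T : K →L[ℂ] K)‖ :=
      ((ContinuousLinearMap.le_opNorm _ _).trans
        (mul_le_of_le_one_right (norm_nonneg _) hw)).trans (norm_sample_sub_le S T s.1)
    have h₃ : ‖sample S s.1 v - sample T s.1 w‖ ≤
        ‖v - w‖ + ‖(S : K →L[ℂ] K) - (T : K →L[ℂ] K)‖ := by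
      rw [h₁]
      exact (norm_add_le _ _).trans (by rw [norm_sample]; gcongr)
    rw [List.length_cons]
    push_cast
    linarith

lemma Algorithm.norm_finalState (A : Algorithm W K) (S : K ≃ₗᵢ[ℂ] K) : ‖A.finalState S‖ = 1 := by
  rw [Algorithm.finalState, norm_foldl_sample, A.norm_init]

lemma Algorithm.norm_finalState_sub_le (A : Algorithm W K) (S T : K ≃ₗᵢ[ℂ] K) :
    ‖A.finalState S - A.finalState T‖ ≤
      A.numSamples * ‖(S : K →L[ℂ] K) - (T : K →L[ℂ] K)‖ := by
  simpa using! norm_foldl_sample_sub_le S T A.steps A.init A.init A.norm_init.le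

end Control

/-! ### Bernoulli laws and rotation samplers -/

section Bits

/-- The element `1` of `{0, 1}`. -/
def oneBit : bits := ⟨1, by simp [bits]⟩

lemma zeroBit_ne_oneBit : zeroBit ≠ oneBit :=
  fun h => zero_ne_one (congrArg Subtype.val h)

lemma eq_zeroBit_or_eq_oneBit (x : bits) : x = zeroBit ∨ x = oneBit := by
  have hx : (x : ℝ) = 0 ∨ (x : ℝ) = 1 := by simpa [bits] using x.2
  exact hx.imp Subtype.ext Subtype.ext

lemma univ_bits : (Finset.univ : Finset bits) = {zeroBit, oneBit} := by
  refine (Finset.eq_univ_of_forall fun x => ?_).symm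
  rw [Finset.mem_insert, Finset.mem_singleton]
  exact eq_zeroBit_or_eq_oneBit x

lemma sum_bits {M : Type*} [AddCommMonoid M] (f : bits → M) :
    ∑ x, f x = f zeroBit + f oneBit := by
  rw [univ_bits, Finset.sum_pair zeroBit_ne_oneBit]

/-- The Bernoulli distribution with mean `p`. -/
def bernoulli (p : ℝ) (x : bits) : ℝ := if x = oneBit then p else 1 - p

@[simp] lemma bernoulli_zeroBit (p : ℝ) : bernoulli p zeroBit = 1 - p := by
  simp [bernoulli, zeroBit_ne_oneBit]

@[simp] lemma bernoulli_oneBit (p : ℝ) : bernoulli p oneBit = p := by simp [bernoulli]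

lemma isDistribution_bernoulli {p : ℝ} (h₀ : 0 ≤ p) (h₁ : p ≤ 1) :
    IsDistribution (bernoulli p) where
  nonneg x := by
    rcases eq_zeroBit_or_eq_oneBit x with rfl | rfl
    · simpa using h₁
    · simpa using h₀
  sum_eq_one := by rw [sum_bits, bernoulli_zeroBit, bernoulli_oneBit, sub_add_cancel]

lemma mean_bernoulli (p : ℝ) : mean (bernoulli p) = p := by
  rw [mean, sum_bits, bernoulli_zeroBit, bernoulli_oneBit]
  simp [zeroBit, oneBit]

lemma phi_bernoulli (p : ℝ) : phi (bernoulli p) = √p := by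
  rw [phi, sum_bits, bernoulli_zeroBit, bernoulli_oneBit]
  simp [zeroBit, oneBit]

/-- The operator with matrix `!![c, -s; s, c]` in the basis `|0⟩`, `|1⟩`. -/
def scaledRotation (c s : ℝ) : ValueSpace bits →ₗ[ℂ] ValueSpace bits where
  toFun v := WithLp.toLp 2 fun x =>
    if x = oneBit then (s : ℂ) * v zeroBit + (c : ℂ) * v oneBit
    else (c : ℂ) * v zeroBit - (s : ℂ) * v oneBit
  map_add' v w := by
    ext x
    simp only [PiLp.add_apply]
    split_ifs <;> ring
  map_smul' a v := by
    ext x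
    simp only [PiLp.smul_apply, smul_eq_mul, RingHom.id_apply]
    split_ifs <;> ring

@[simp] lemma scaledRotation_zeroBit (c s : ℝ) (v : ValueSpace bits) :
    scaledRotation c s v zeroBit = (c : ℂ) * v zeroBit - (s : ℂ) * v oneBit := by
  simp [scaledRotation, zeroBit_ne_oneBit]

@[simp] lemma scaledRotation_oneBit (c s : ℝ) (v : ValueSpace bits) :
    scaledRotation c s v oneBit = (s : ℂ) * v zeroBit + (c : ℂ) * v oneBit := by
  simp [scaledRotation]

lemma ext_bits {v w : ValueSpace bits} (h₀ : v zeroBit = w zeroBit) (h₁ : v oneBit = w oneBit) :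
    v = w := by
  ext x
  rcases eq_zeroBit_or_eq_oneBit x with rfl | rfl
  exacts [h₀, h₁]

lemma norm_sq_scaledRotation (c s : ℝ) (v : ValueSpace bits) :
    ‖scaledRotation c s v‖ ^ 2 = (c ^ 2 + s ^ 2) * ‖v‖ ^ 2 := by
  simp only [EuclideanSpace.norm_sq_eq, sum_bits, scaledRotation_zeroBit, scaledRotation_oneBit,
    ← Complex.normSq_eq_norm_sq, Complex.normSq_apply, Complex.add_re, Complex.add_im,
    Complex.sub_re, Complex.sub_im, Complex.re_ofReal_mul, Complex.im_ofReal_mul]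
  ring

/-- Stated without `c ^ 2 + s ^ 2 = 1` because the difference of two rotations has the same matrix
form; this yields their distance. -/
lemma norm_scaledRotation (c s : ℝ) (v : ValueSpace bits) :
    ‖scaledRotation c s v‖ = √(c ^ 2 + s ^ 2) * ‖v‖ := by
  rw [← Real.sqrt_sq (norm_nonneg (scaledRotation c s v)), norm_sq_scaledRotation,
    Real.sqrt_mul (by positivity), Real.sqrt_sq (norm_nonneg v)]

/-- The rotation with matrix `!![c, -s; s, c]` in the basis `|0⟩`, `|1⟩`. -/
def rotation (c s : ℝ) (h : c ^ 2 + s ^ 2 = 1) : ValueSpace bits ≃ₗᵢ[ℂ] ValueSpace bits where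
  toLinearEquiv := LinearEquiv.ofLinearMap (scaledRotation c s) (scaledRotation c (-s))
    (by
      have h' : (c : ℂ) ^ 2 + (s : ℂ) ^ 2 = 1 := by exact_mod_cast h
      ext1 v
      refine ext_bits ?_ ?_ <;> simp
      · linear_combination v zeroBit * h'
      · linear_combination v oneBit * h')
    (by
      have h' : (c : ℂ) ^ 2 + (s : ℂ) ^ 2 = 1 := by exact_mod_cast h
      ext1 v
      refine ext_bits ?_ ?_ <;> simp
      · linear_combination v zeroBit * h'
      · linear_combination v oneBit * h')
  norm_map' v := by
    change ‖scaledRotation c s v‖ = ‖v‖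
    rw [norm_scaledRotation, h, Real.sqrt_one, one_mul]

lemma rotation_apply (c s : ℝ) (h : c ^ 2 + s ^ 2 = 1) (v : ValueSpace bits) :
    rotation c s h v = scaledRotation c s v := rfl

variable (Hg : Type*) [NormedAddCommGroup Hg] [InnerProductSpace ℂ Hg]

/-- The sampler that rotates the value register and ignores the garbage register. -/
def rotationSampler (c s : ℝ) (h : c ^ 2 + s ^ 2 = 1) :
    SampleSpace Hg bits ≃ₗᵢ[ℂ] SampleSpace Hg bits :=
  (rotation c s h).lTensor Hg

variable {Hg}

lemma isSampler_rotationSampler {g₀ : Hg} (hg : ‖g₀‖ = 1) {p c s : ℝ} (h : c ^ 2 + s ^ 2 = 1)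
    (hc : c = √(1 - p)) (hs : s = √p) :
    IsSampler g₀ zeroBit (bernoulli p) (rotationSampler Hg c s h) := by
  refine ⟨fun _ => g₀, fun _ => hg, ?_⟩
  have h₁ : rotation c s h (ket zeroBit) = (c : ℂ) • ket zeroBit + (s : ℂ) • ket oneBit := by
    rw [rotation_apply]
    refine ext_bits ?_ ?_ <;>
      simp [ket, zeroBit_ne_oneBit, zeroBit_ne_oneBit.symm]
  have h₂ : rotationSampler Hg c s h (g₀ ⊗ₜ[ℂ] ket zeroBit) =
      g₀ ⊗ₜ[ℂ] rotation c s h (ket zeroBit) := rfl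
  rw [h₂, h₁, sum_bits, bernoulli_zeroBit, bernoulli_oneBit, ← hc, ← hs, TensorProduct.tmul_add,
    TensorProduct.tmul_smul, TensorProduct.tmul_smul]

lemma coe_rotationSampler (c s : ℝ) (h : c ^ 2 + s ^ 2 = 1) :
    (rotationSampler Hg c s h : SampleSpace Hg bits →L[ℂ] SampleSpace Hg bits) =
      (rotation c s h : ValueSpace bits →L[ℂ] ValueSpace bits).lTensor Hg := by
  refine ContinuousLinearMap.ext fun x => ?_
  induction x using TensorProduct.induction_on with
  | zero => simp
  | add x y hx hy => rw [map_add, map_add, hx, hy]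
  | tmul g v => rfl

lemma norm_rotationSampler_sub_le {c s c' s' : ℝ} (h : c ^ 2 + s ^ 2 = 1)
    (h' : c' ^ 2 + s' ^ 2 = 1) :
    ‖(rotationSampler Hg c s h : SampleSpace Hg bits →L[ℂ] SampleSpace Hg bits) -
      (rotationSampler Hg c' s' h' : SampleSpace Hg bits →L[ℂ] SampleSpace Hg bits)‖ ≤
      |c - c'| + |s - s'| := by
  have h₁ : (rotationSampler Hg c s h : SampleSpace Hg bits →L[ℂ] SampleSpace Hg bits) -
      (rotationSampler Hg c' s' h' : SampleSpace Hg bits →L[ℂ] SampleSpace Hg bits) =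
      ((rotation c s h : ValueSpace bits →L[ℂ] ValueSpace bits) -
        (rotation c' s' h' : ValueSpace bits →L[ℂ] ValueSpace bits)).lTensor Hg := by
    rw [ContinuousLinearMap.lTensor_sub, coe_rotationSampler, coe_rotationSampler]
  rw [h₁]
  refine (ContinuousLinearMap.norm_lTensor_le (G := Hg) _).trans
    (ContinuousLinearMap.opNorm_le_bound _ (by positivity) fun v => ?_)
  have h₂ : ((rotation c s h : ValueSpace bits →L[ℂ] ValueSpace bits) -
      (rotation c' s' h' : ValueSpace bits →L[ℂ] ValueSpace bits)) v =
      scaledRotation (c - c') (s - s') v := by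
    change scaledRotation c s v - scaledRotation c' s' v = _
    refine ext_bits ?_ ?_ <;> simp <;> ring
  rw [h₂, norm_scaledRotation]
  gcongr
  refine (Real.sqrt_le_left (by positivity)).2 ?_
  nlinarith [sq_abs (c - c'), sq_abs (s - s'), abs_nonneg (c - c'), abs_nonneg (s - s'),
    mul_nonneg (abs_nonneg (c - c')) (abs_nonneg (s - s'))]

end Bits

/-! ### Estimates for square roots -/

lemma sqrt_div_mem_Icc {Δ p : ℝ} (hΔ : 1 < Δ) (h₀ : 1 / (16 * Δ ^ 2) ≤ p) (h₁ : p ≤ 1 / Δ ^ 2) :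
    √p / p ∈ Set.Icc Δ (4 * Δ) := by
  have hΔ₀ : 0 < Δ := by linarith
  have hp : 0 < p := lt_of_lt_of_le (by positivity) h₀
  have hs : 0 < √p := Real.sqrt_pos.2 hp
  have hss : √p ^ 2 = p := Real.sq_sqrt hp.le
  rw [div_le_iff₀ (by positivity)] at h₀
  rw [le_div_iff₀ (by positivity)] at h₁
  have e : √p / p = 1 / √p := by rw [Real.sqrt_div_self']
  rw [e]
  refine ⟨?_, ?_⟩
  · rw [le_div_iff₀ hs]
    refine (pow_le_one_iff_of_nonneg (by positivity) two_ne_zero).1 ?_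
    rw [mul_pow, hss]
    linarith
  · rw [div_le_iff₀ hs]
    refine (one_le_pow_iff_of_nonneg (by positivity) two_ne_zero).1 ?_
    rw [mul_pow, hss]
    linarith

lemma abs_sqrt_sub_sqrt_le {a b m : ℝ} (hm : 0 < m) (ha : 0 ≤ a) (hb : 0 ≤ b) (hab : m ≤ √a) :
    |√a - √b| ≤ |a - b| / m := by
  rw [le_div_iff₀ hm]
  have h : |a - b| = |√a - √b| * (√a + √b) := by
    rw [← abs_of_nonneg (add_nonneg (Real.sqrt_nonneg a) (Real.sqrt_nonneg b)), ← abs_mul]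
    congr 1
    nlinarith [Real.sq_sqrt hb, Real.sq_sqrt ha]
  rw [h]
  gcongr
  linarith [Real.sqrt_nonneg b]

end QuantumSampling

end

/-! ### The lower bound -/

open QuantumSampling in
theorem mainTheorem3 :
    ∃ c : ℝ, 0 < c ∧
      ∀ (ε Δ : ℝ), 0 < ε → ε < 1 / 5 → 1 < Δ →
      ∀ (Hg W : Type*) [NormedAddCommGroup Hg] [InnerProductSpace ℂ Hg]
        [NormedAddCommGroup W] [InnerProductSpace ℂ W]
        (g₀ : Hg), ‖g₀‖ = 1 →
      ∀ A : Algorithm W (SampleSpace Hg bits),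
        A.SolvesMeanEstimation g₀ zeroBit ε Δ →
          c * ((Δ - 1) / ε) ≤ (A.numSamples : ℝ) := by
  refine ⟨1 / 24, by norm_num, fun ε Δ hε hε' hΔ Hg W _ _ _ _ g₀ hg A hA => ?_⟩
  have hΔ₀ : 0 < Δ := by linarith
  have hΔ₁ : 0 < Δ - 1 := by linarith
  obtain ⟨p, hp⟩ : ∃ p, p = 1 / Δ ^ 2 := ⟨_, rfl⟩
  obtain ⟨q, hq⟩ : ∃ q, q = (1 - 2 * ε) * p := ⟨_, rfl⟩
  have hp₀ : 0 < p := by rw [hp]; positivity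
  have hpΔ : p * Δ ^ 2 = 1 := by rw [hp]; field_simp
  have hp₁ : p < 1 := by nlinarith
  have hq₀ : 0 < q := by rw [hq]; exact mul_pos (by linarith) hp₀
  have hqp : q < p := by nlinarith
  have h16 : 1 / (16 * Δ ^ 2) = p / 16 := by rw [hp]; field_simp
  have hc : ∀ r : ℝ, 0 ≤ r → r ≤ 1 → √(1 - r) ^ 2 + √r ^ 2 = 1 := fun r h₀ h₁ => by
    rw [Real.sq_sqrt h₀, Real.sq_sqrt (by linarith)]; ring
  have hpc := hc p hp₀.le hp₁.le
  have hqc := hc q hq₀.le (by linarith)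
  have key : ∀ r (h₀ : 0 ≤ r) (h₁ : r ≤ 1), p / 16 ≤ r → r ≤ p →
      2 / 3 ≤ A.prob (rotationSampler Hg √(1 - r) √r (hc r h₀ h₁)) {m | |m - r| ≤ ε * r} := by
    intro r h₀ h₁ h₂ h₃
    have h := hA (bernoulli r) (rotationSampler Hg √(1 - r) √r (hc r h₀ h₁))
      (isDistribution_bernoulli h₀ h₁) (isSampler_rotationSampler hg _ rfl rfl)
    rw [phi_bernoulli, mean_bernoulli] at h
    exact h (sqrt_div_mem_Icc hΔ (h16 ▸ h₂) (hp ▸ h₃))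
  -- The upper end for `q` is `(1 - 2 * ε) * (1 + ε) * p = (1 - ε - 2 * ε ^ 2) * p`, below the lower
  -- end `(1 - ε) * p` for `p`.
  have hdisj : Disjoint {m | |m - p| ≤ ε * p} {m | |m - q| ≤ ε * q} := by
    refine Set.disjoint_left.2 fun m hm hm' => ?_
    have h₁ := (abs_le.1 (show |m - p| ≤ ε * p from hm)).1
    have h₂ := (abs_le.1 (show |m - q| ≤ ε * q from hm')).2
    have h₃ : 0 < ε * ε * p := by positivity
    rw [hq] at h₂
    nlinarith
  have h₁ := A.measurement.one_div_six_le_norm_sub hdisj (A.norm_finalState _)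
    (A.norm_finalState _) (key p hp₀.le hp₁.le (by linarith) le_rfl)
    (key q hq₀.le (by linarith) (by rw [hq]; nlinarith) hqp.le)
  have h₂ := A.norm_finalState_sub_le (rotationSampler Hg √(1 - p) √p hpc)
    (rotationSampler Hg √(1 - q) √q hqc)
  have h₃ := norm_rotationSampler_sub_le (Hg := Hg) hpc hqc
  have hsp : 1 / Δ ≤ √p := by
    rw [hp, Real.sqrt_div zero_le_one, Real.sqrt_one, Real.sqrt_sq hΔ₀.le]
  -- Amounts to `(Δ - 1) ^ 2 ≤ Δ ^ 2 - 1`. This factor, degenerate as `Δ → 1`, is where `Δ - 1`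
  -- enters the bound.
  have hsp' : (Δ - 1) / Δ ≤ √(1 - p) := by
    refine Real.le_sqrt_of_sq_le ?_
    rw [div_pow, div_le_iff₀ (by positivity)]
    nlinarith
  have h₄ := abs_sqrt_sub_sqrt_le (by positivity) hp₀.le hq₀.le hsp
  have h₅ := abs_sqrt_sub_sqrt_le (b := 1 - q) (by positivity) (by linarith) (by linarith) hsp'
  have e₁ : |p - q| = 2 * ε / Δ ^ 2 := by
    rw [abs_of_pos (by linarith), hq, hp]; ring
  have e₂ : |1 - p - (1 - q)| = 2 * ε / Δ ^ 2 := by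
    rw [← e₁, abs_sub_comm]; congr 1; ring
  have b₁ : |√p - √q| ≤ 2 * ε / (Δ - 1) := by
    refine h₄.trans ?_
    rw [e₁, div_div, div_le_div_iff₀ (by positivity) hΔ₁]
    have : Δ ^ 2 * (1 / Δ) = Δ := by field_simp
    rw [this]
    nlinarith
  have b₂ : |√(1 - p) - √(1 - q)| ≤ 2 * ε / (Δ - 1) := by
    refine h₅.trans ?_
    rw [e₂, div_div, div_le_div_iff₀ (by positivity) hΔ₁]
    have : Δ ^ 2 * ((Δ - 1) / Δ) = Δ * (Δ - 1) := by field_simp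
    rw [this]
    nlinarith [mul_pos hε hΔ₁, mul_pos (mul_pos hε hΔ₁) hΔ₁]
  have h₆ : 1 / 6 ≤ (A.numSamples : ℝ) * (4 * ε / (Δ - 1)) := by
    refine (h₁.trans h₂).trans ?_
    gcongr
    refine h₃.trans ((add_le_add b₂ b₁).trans_eq ?_)
    ring
  rw [← mul_div_assoc, le_div_iff₀ hΔ₁] at h₆
  rw [← mul_div_assoc, div_le_iff₀ hε]
  linarith
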